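/- Let $n\ge 1$, $0<s<1$, $\omega>0$, and let $d\gamma(x)=(2\pi)^{-n/2}e^{-|x|^2/2}\,dx$ be the standard Gaussian measure on $\mathbb R^n$, $\mathcal L=-\Delta+x\cdot\nabla$, $H=\{x\in\mathbb R^n:x_1>0\}$ and $H_\omega=\{x\in\mathbb R^n:x_1>\omega\}$. For an open set $\Omega\subset\mathbb R^n$ with $\gamma(\Omega)<1$ put $\mathcal C_\Omega=\Omega\times(0,\infty)$ and $a=1-2s$. Let $H^1_{0,L}(\mathcal C_\Omega)$ be the space of functions on $\mathcal C_\Omega$ that vanish on the lateral boundary $\partial\Omega\times[0,\infty)$, defined as the closure of the (restrictions to $\mathcal C_\Omega$ of) functions in $C_c^\infty(\Omega\times\mathbb R)$ in the norm $\big(\iint_{\mathcal C_\Omega}y^a(w^2+|\nabla_{x,y}w|^2)\,d\gamma(x)\,dy\big)^{1/2}$, and let $v\mapsto v(\cdot,0)\in L^2(\Omega,\gamma)$ be the trace on this space, the continuous extension of restriction to $y=0$. A function $u$ is a weak solution of $$\mathcal L^su=f\ \text{ in }\Omega,\qquad u=0\ \text{ on }\partial\Omega,$$ if $u=w(\cdot,0)$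 for some $w\in H^1_{0,L}(\mathcal C_\Omega)$ such that, for every $v\in H^1_{0,L}(\mathcal C_\Omega)$, the function $f\,v(\cdot,0)$ is $\gamma$-integrable on $\Omega$ and $$\iint_{\mathcal C_\Omega}y^a\,\nabla_{x,y}w\cdot\nabla_{x,y}v\,d\gamma(x)\,dy=c_s\int_\Omega f(x)\,v(x,0)\,d\gamma(x),\qquad c_s=\frac{\Gamma(1-s)}{4^{s-1/2}\,\Gamma(s)} .$$ Let $1\le p<\infty$, $\alpha\in\mathbb R$, and let $h:H_\omega\to\mathbb R$ be a measurable function in the Zygmund space $L^p(\log L)^\alpha(H_\omega,\gamma)$, that is, $\int_{H_\omega}\big[|h|\log^\alpha(2+|h|)\big]^p\,d\gamma<\infty$. Suppose that $h\ge 0$ a.e. and that $h$ is rearranged, i.e. for a.e. $x\in H_\omega$ $$h(x)=h^{\bigstar}(x):=\inf\Big\{t\ge 0:\ \gamma\big(\{z\in H_\omega:|h(z)|>t\}\big)\le\Phi(x_1)\Big\},\qquad \Phi(\lambda)=\frac1{\sqrt{2\pi}}\int_\lambda^\infty e^{-r^2/2}\,dr .$$ Let $\psi$ be a weak solution of $\mathcal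 L^s\psi=h$ in $H_\omega$, $\psi=0$ on $\partial H_\omega$, and let $\zeta$ be a weak solution of $\mathcal L^s\zeta=\overline h$ in $H$, $\zeta=0$ on $\partial H$, where $\overline h$ is the extension of $h$ by zero to $H\setminus H_\omega$. Then $$\psi(x)\le\zeta(x)\qquad\text{for a.e. }x\in H_\omega .$$ -/

import Mathlib

open MeasureTheory Filter Topology Set

noncomputable section

namespace GaussOU

/-- The standard Gaussian measure on `ℝⁿ`, with density `(2π)^{-n/2} exp(-|x|²/2)`. -/
def gaussian (n : ℕ) : Measure (EuclideanSpace ℝ (Fin n)) :=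
  volume.withDensity fun x =>
    ENNReal.ofReal ((2 * Real.pi) ^ (-(n : ℝ) / 2) * Real.exp (-‖x‖ ^ 2 / 2))

/-- The half-space `{x : x₁ > ω}`. -/
def halfSpace (n : ℕ) [NeZero n] (ω : ℝ) : Set (EuclideanSpace ℝ (Fin n)) :=
  {x | ω < x 0}

/-! ### Gaussian rearrangements -/

/-- `Φ(l) = (2π)^{-1/2} ∫_l^∞ exp(-r²/2) dr`. -/
def Phi (l : ℝ) : ℝ :=
  (1 / Real.sqrt (2 * Real.pi)) * ∫ r in Ioi l, Real.exp (-r ^ 2 / 2)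

/-- The distribution function `t ↦ γ {x ∈ Ω : |u x| > t}`. -/
def distribution {n : ℕ} (Ω : Set (EuclideanSpace ℝ (Fin n)))
    (u : EuclideanSpace ℝ (Fin n) → ℝ) (t : ℝ) : ℝ :=
  (gaussian n).real {x | x ∈ Ω ∧ t < |u x|}

/-- The one dimensional decreasing Gaussian rearrangement of `u : Ω → ℝ`. -/
def rearr1 {n : ℕ} (Ω : Set (EuclideanSpace ℝ (Fin n)))
    (u : EuclideanSpace ℝ (Fin n) → ℝ) (r : ℝ) : ℝ :=
  sInf {t : ℝ | 0 ≤ t ∧ distribution Ω u t ≤ r}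

/-- The `n`-dimensional Gaussian rearrangement of `u : Ω → ℝ`, as a function of `x`
in the half-space with the same Gaussian measure as `Ω`. -/
def rearr {n : ℕ} [NeZero n] (Ω : Set (EuclideanSpace ℝ (Fin n)))
    (u : EuclideanSpace ℝ (Fin n) → ℝ) (x : EuclideanSpace ℝ (Fin n)) : ℝ :=
  rearr1 Ω u (Phi (x 0))

/-- The Zygmund space `L^p (log L)^α (Ω, γ)`. -/
def MemZygmund {n : ℕ} (p α : ℝ) (Ω : Set (EuclideanSpace ℝ (Fin n)))
    (u : EuclideanSpace ℝ (Fin n) → ℝ) : Prop :=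
  AEMeasurable u ((gaussian n).restrict Ω) ∧
    ∫⁻ x in Ω, ENNReal.ofReal ((|u x| * Real.log (2 + |u x|) ^ α) ^ p) ∂(gaussian n) < ⊤

/-! ### The energy space on the cylinder `Ω × (0, ∞)` -/

/-- The measure `dγ(x) ⊗ y^a dy`, `a = 1 - 2s`, on the cylinder `Ω × (0, ∞)`. -/
def cylMeasure {n : ℕ} (s : ℝ) (Ω : Set (EuclideanSpace ℝ (Fin n))) :
    Measure (EuclideanSpace ℝ (Fin n) × ℝ) :=
  ((gaussian n).restrict Ω).prod
    ((volume.restrict (Ioi (0 : ℝ))).withDensity fun y => ENNReal.ofReal (y ^ (1 - 2 * s)))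

/-- The gradient in the variable `x`. -/
def gradX {n : ℕ} (φ : EuclideanSpace ℝ (Fin n) × ℝ → ℝ)
    (z : EuclideanSpace ℝ (Fin n) × ℝ) : EuclideanSpace ℝ (Fin n) :=
  gradient (fun x => φ (x, z.2)) z.1

/-- The derivative in the variable `y`. -/
def derivY {n : ℕ} (φ : EuclideanSpace ℝ (Fin n) × ℝ → ℝ)
    (z : EuclideanSpace ℝ (Fin n) × ℝ) : ℝ :=
  deriv (fun y => φ (z.1, y)) z.2

/-- Smooth functions on `ℝⁿ × ℝ` whose support is a compact subset of `Ω × ℝ`. On the closed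
cylinder `Ω × [0, ∞)` they vanish near the lateral boundary `∂Ω × [0, ∞)`, while their values
on the base `y = 0` are free. -/
def IsTest {n : ℕ} (Ω : Set (EuclideanSpace ℝ (Fin n)))
    (φ : EuclideanSpace ℝ (Fin n) × ℝ → ℝ) : Prop :=
  ContDiff ℝ ((⊤ : ℕ∞) : WithTop ℕ∞) φ ∧ HasCompactSupport φ ∧ tsupport φ ⊆ Ω ×ˢ (univ : Set ℝ)

/-- `w` belongs to the weighted Sobolev space `H¹_{0,L}(Ω × (0,∞), dγ(x) ⊗ y^a dy)` of functions
vanishing on the lateral boundary, i.e. to the closure of the test functions in the norm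
`(∬ y^a (w² + |∇_{x,y} w|²) dγ dy)^{1/2}`; its weak gradient is `(G, g)` (`G` in the variable `x`,
`g` in the variable `y`), and its trace on the base `Ω × {0}`, the continuous extension of
`φ ↦ φ(·, 0)` to this closure, is `u`. -/
structure MemEnergy {n : ℕ} (s : ℝ) (Ω : Set (EuclideanSpace ℝ (Fin n)))
    (w : EuclideanSpace ℝ (Fin n) × ℝ → ℝ)
    (G : EuclideanSpace ℝ (Fin n) × ℝ → EuclideanSpace ℝ (Fin n))
    (g : EuclideanSpace ℝ (Fin n) × ℝ → ℝ) (u : EuclideanSpace ℝ (Fin n) → ℝ) : Prop where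
  memLp : MemLp w 2 (cylMeasure s Ω)
  memLp_gradX : MemLp G 2 (cylMeasure s Ω)
  memLp_derivY : MemLp g 2 (cylMeasure s Ω)
  memLp_trace : MemLp u 2 ((gaussian n).restrict Ω)
  approx : ∃ φ : ℕ → EuclideanSpace ℝ (Fin n) × ℝ → ℝ,
    (∀ k, IsTest Ω (φ k)) ∧
    Tendsto (fun k => eLpNorm (fun z => φ k z - w z) 2 (cylMeasure s Ω)) atTop (𝓝 0) ∧
    Tendsto (fun k => eLpNorm (fun z => gradX (φ k) z - G z) 2 (cylMeasure s Ω))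
      atTop (𝓝 0) ∧
    Tendsto (fun k => eLpNorm (fun z => derivY (φ k) z - g z) 2 (cylMeasure s Ω))
      atTop (𝓝 0) ∧
    Tendsto (fun k => eLpNorm (fun x => φ k (x, 0) - u x) 2 ((gaussian n).restrict Ω))
      atTop (𝓝 0)

/-! ### Weak solutions -/

/-- The constant `c_s = Γ(1-s) / (4^{s-1/2} Γ(s))`, for which
`-lim_{y → 0⁺} y^a ∂_y w = c_s 𝓛^s u` when `w` is the extension of `u`. -/
def extConst (s : ℝ) : ℝ :=
  Real.Gamma (1 - s) / (4 ^ (s - 1 / 2) * Real.Gamma s)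

/-- `u` is a weak solution of `𝓛^s u = f` in `Ω`, `u = 0` on `∂Ω`: it is the trace on `Ω` of a
function `w` (with weak gradient `(G, g)`) in the energy space that solves
`-div(y^a φ(x) ∇w) = 0` in `Ω × (0, ∞)`, `w = 0` on `∂Ω × [0, ∞)`,
`-lim_{y → 0⁺} y^a ∂_y w = c_s f` on `Ω` in the weak sense. The datum `f` acts on the energy space
by integration against traces. -/
def IsWeakSolution {n : ℕ} (s : ℝ) (Ω : Set (EuclideanSpace ℝ (Fin n)))
    (f u : EuclideanSpace ℝ (Fin n) → ℝ) : Prop :=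
  ∃ (w : EuclideanSpace ℝ (Fin n) × ℝ → ℝ)
    (G : EuclideanSpace ℝ (Fin n) × ℝ → EuclideanSpace ℝ (Fin n))
    (g : EuclideanSpace ℝ (Fin n) × ℝ → ℝ),
    MemEnergy s Ω w G g u ∧
    ∀ (v : EuclideanSpace ℝ (Fin n) × ℝ → ℝ)
      (V : EuclideanSpace ℝ (Fin n) × ℝ → EuclideanSpace ℝ (Fin n))
      (v' : EuclideanSpace ℝ (Fin n) × ℝ → ℝ) (τ : EuclideanSpace ℝ (Fin n) → ℝ),
      MemEnergy s Ω v V v' τ →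
        Integrable (fun x => f x * τ x) ((gaussian n).restrict Ω) ∧
        ∫ z, (inner ℝ (G z) (V z) + g z * v' z) ∂(cylMeasure s Ω)
          = extConst s * ∫ x in Ω, f x * τ x ∂(gaussian n)

end GaussOU

end

/-! The theorem is a weak maximum principle for the extension problem on nested cylinders; the only
property of the datum that matters is `h ≥ 0`. Let `w₁`, `w₂` be the extensions of `ψ`, `ζ`.

Testing the equation of `w₂` with `min(w₂, 0)` shows that the gradient of `w₂` vanishes a.e. where
`w₂ ≤ 0` (`ae_gradient_eq_zero_of_nonpos`). Next, `v = (w₁ - w₂⁺)⁺`, extended by zero, is admissible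
in both equations, and both then have the same right-hand side. Subtracting them, and using that
`w₂` and `w₂⁺` have the same gradient, gives `∬ y^a |∇v|² = 0`. So `v` has zero trace, i.e. `ψ ≤
ζ⁺`, and likewise `ζ = ζ⁺`.

Two facts carry the argument. Positive parts stay in the energy space, which is a closure of smooth
functions, so they are built from smooth truncations and a diagonal sequence
(`EnergyLim.exists_pos`). A function with zero `y`-derivative has zero trace
(`EnergyLim.trace_ae_eq_zero`), because the cylinder is infinite in `y`; this takes the place of a
Poincaré inequality. -/

namespace GaussOU

/-! ### Smooth truncations of the positive part -/

/-- The derivative of `r ↦ r * smoothTransition (r - 1)`. -/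
noncomputable def truncProfile (r : ℝ) : ℝ :=
  Real.smoothTransition (r - 1) + r * deriv Real.smoothTransition (r - 1)

/-- A smooth approximation of `t ↦ max t 0`, vanishing for `t ≤ 1 / (N + 1)` and equal to `t` for
`t ≥ 2 / (N + 1)`. -/
noncomputable def trunc (N : ℕ) (t : ℝ) : ℝ :=
  t * Real.smoothTransition ((N + 1) * t - 1)

/-- The indicator function of `(0, ∞)`. -/
noncomputable def posInd (t : ℝ) : ℝ := if 0 < t then 1 else 0

theorem contDiff_smoothTransition :
    ContDiff ℝ ((⊤ : ℕ∞) : WithTop ℕ∞) Real.smoothTransition :=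
  Real.smoothTransition.contDiff

theorem contDiff_trunc (N : ℕ) : ContDiff ℝ ((⊤ : ℕ∞) : WithTop ℕ∞) (trunc N) := by
  unfold trunc
  exact contDiff_id.mul (contDiff_smoothTransition.comp (by fun_prop))

theorem continuous_truncProfile : Continuous truncProfile := by
  have h : Continuous (deriv Real.smoothTransition) :=
    contDiff_smoothTransition.continuous_deriv (by simp)
  unfold truncProfile
  have := Real.smoothTransition.continuous
  fun_prop

theorem truncProfile_of_lt {r : ℝ} (hr : r < 1) : truncProfile r = 0 := by
  have h : Real.smoothTransition =ᶠ[𝓝 (r - 1)] fun _ => 0 := by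
    filter_upwards [Iio_mem_nhds (show r - 1 < 0 by linarith)] with t ht
    exact Real.smoothTransition.zero_of_nonpos (le_of_lt ht)
  simp [truncProfile, h.deriv_eq, h.eq_of_nhds]

theorem truncProfile_of_gt {r : ℝ} (hr : 2 < r) : truncProfile r = 1 := by
  have h : Real.smoothTransition =ᶠ[𝓝 (r - 1)] fun _ => 1 := by
    filter_upwards [Ioi_mem_nhds (show 1 < r - 1 by linarith)] with t ht
    exact Real.smoothTransition.one_of_one_le (le_of_lt ht)
  simp [truncProfile, h.deriv_eq, h.eq_of_nhds]

/-- The profile is continuous and constant outside `[1, 2]`. The requirement `1 ≤ C` lets the same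
constant bound the limit `posInd`. -/
theorem exists_truncProfile_bound : ∃ C : NNReal, 1 ≤ C ∧ ∀ r, |truncProfile r| ≤ C := by
  obtain ⟨C, hC⟩ := (isCompact_Icc (a := (0 : ℝ)) (b := 3)).exists_bound_of_continuousOn
    continuous_truncProfile.continuousOn
  refine ⟨⟨max C 1, by positivity⟩, NNReal.coe_le_coe.1 (le_max_right C 1), fun r => ?_⟩
  change |truncProfile r| ≤ max C 1
  by_cases h0 : r < 0
  · rw [truncProfile_of_lt (by linarith)]; simp
  by_cases h3 : 3 < r
  · rw [truncProfile_of_gt (by linarith)]; simp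
  · exact (hC r ⟨not_lt.1 h0, not_lt.1 h3⟩).trans (le_max_left _ _)

/-- The factor `N + 1` from the chain rule is absorbed by `t`: the derivative is a fixed profile at
the rescaled point, hence bounded independently of `N`. -/
theorem hasDerivAt_trunc (N : ℕ) (t : ℝ) :
    HasDerivAt (trunc N) (truncProfile ((N + 1) * t)) t := by
  have h1 : HasDerivAt (fun t : ℝ => ((N : ℝ) + 1) * t - 1) ((N : ℝ) + 1) t := by
    simpa using ((hasDerivAt_id t).const_mul ((N : ℝ) + 1)).sub_const 1
  have h2 : HasDerivAt Real.smoothTransition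
      (deriv Real.smoothTransition (((N : ℝ) + 1) * t - 1)) (((N : ℝ) + 1) * t - 1) :=
    (contDiff_smoothTransition.differentiable (by simp) _).hasDerivAt
  refine ((hasDerivAt_id t).mul (h2.comp t h1)).congr_deriv ?_
  simp [truncProfile]
  ring

theorem trunc_nonneg (N : ℕ) (t : ℝ) : 0 ≤ trunc N t := by
  unfold trunc
  by_cases ht : t ≤ 0
  · rw [Real.smoothTransition.zero_of_nonpos]
    · simp
    · nlinarith [Nat.cast_nonneg (α := ℝ) N]
  · exact mul_nonneg (not_le.1 ht).le (Real.smoothTransition.nonneg _)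

theorem trunc_of_nonpos (N : ℕ) {t : ℝ} (ht : t ≤ 0) : trunc N t = 0 := by
  unfold trunc
  rw [Real.smoothTransition.zero_of_nonpos]
  · simp
  · nlinarith [Nat.cast_nonneg (α := ℝ) N]

theorem trunc_le (N : ℕ) (t : ℝ) : trunc N t ≤ max t 0 := by
  by_cases ht : t ≤ 0
  · rw [trunc_of_nonpos N ht]; simp
  · refine le_trans ?_ (le_max_left _ _)
    exact mul_le_of_le_one_right (not_le.1 ht).le (Real.smoothTransition.le_one _)

theorem abs_trunc_sub_le (N : ℕ) (t : ℝ) : |trunc N t - max t 0| ≤ |t| := by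
  have h1 := trunc_nonneg N t
  have h2 := trunc_le N t
  rw [abs_sub_comm, abs_of_nonneg (by linarith)]
  have : max t 0 ≤ |t| := max_le (le_abs_self t) (abs_nonneg t)
  linarith

theorem eventually_large_mul {t : ℝ} (ht : 0 < t) :
    ∀ᶠ N : ℕ in atTop, 2 < ((N : ℝ) + 1) * t := by
  have h : Tendsto (fun N : ℕ => ((N : ℝ) + 1) * t) atTop atTop :=
    (tendsto_atTop_add_const_right _ _ tendsto_natCast_atTop_atTop).atTop_mul_const ht
  exact h.eventually_gt_atTop 2

theorem tendsto_trunc (t : ℝ) : Tendsto (fun N => trunc N t) atTop (𝓝 (max t 0)) := by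
  refine tendsto_const_nhds.congr' ?_
  by_cases ht : t ≤ 0
  · exact Eventually.of_forall fun N => by simp only [trunc_of_nonpos N ht, max_eq_right ht]
  · filter_upwards [eventually_large_mul (not_le.1 ht)] with N hN
    rw [trunc, Real.smoothTransition.one_of_one_le (by linarith), max_eq_left (not_le.1 ht).le,
      mul_one]

/-- For each `t` the sequence is eventually constant. At `t = 0` it is identically `0`, in
accordance with the strict inequality in `posInd`. -/
theorem tendsto_truncProfile (t : ℝ) :
    Tendsto (fun N : ℕ => truncProfile ((N + 1) * t)) atTop (𝓝 (posInd t)) := by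
  refine tendsto_const_nhds.congr' ?_
  by_cases ht : t ≤ 0
  · refine Eventually.of_forall fun N => ?_
    beta_reduce
    rw [truncProfile_of_lt, posInd, if_neg (not_lt.2 ht)]
    nlinarith [Nat.cast_nonneg (α := ℝ) N]
  · filter_upwards [eventually_large_mul (not_le.1 ht)] with N hN
    rw [truncProfile_of_gt hN, posInd, if_pos (not_le.1 ht)]

theorem measurable_posInd : Measurable posInd :=
  Measurable.ite measurableSet_Ioi measurable_const measurable_const

theorem abs_posInd_le (t : ℝ) : |posInd t| ≤ 1 := by
  unfold posInd; split_ifs <;> simp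

/-! ### Convergence in `L²` -/

section L2

variable {X F : Type*} [MeasurableSpace X] {μ : Measure X} [NormedAddCommGroup F]

theorem tendsto_eLpNorm_two_of_dominated {f : ℕ → X → F} {b : X → ℝ}
    (hf : ∀ k, AEStronglyMeasurable (f k) μ) (hb : MemLp b 2 μ)
    (hle : ∀ k, ∀ᵐ x ∂μ, ‖f k x‖ ≤ ‖b x‖)
    (hlim : ∀ᵐ x ∂μ, Tendsto (fun k => f k x) atTop (𝓝 0)) :
    Tendsto (fun k => eLpNorm (f k) 2 μ) atTop (𝓝 0) := by
  simp only [eLpNorm_eq_lintegral_rpow_enorm_toReal two_ne_zero ENNReal.ofNat_ne_top]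
  have hfin : ∫⁻ x, ‖b x‖ₑ ^ (2 : ENNReal).toReal ∂μ ≠ ⊤ :=
    (lintegral_rpow_enorm_lt_top_of_eLpNorm_lt_top two_ne_zero ENNReal.ofNat_ne_top
      hb.eLpNorm_lt_top).ne
  have h := tendsto_lintegral_of_dominated_convergence' (μ := μ)
    (F := fun k x => ‖f k x‖ₑ ^ (2 : ENNReal).toReal) (f := fun _ => 0)
    (fun x => ‖b x‖ₑ ^ (2 : ENNReal).toReal) (fun k => (hf k).enorm.pow_const _)
    (fun k => ?_) hfin ?_
  · rw [lintegral_zero] at h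
    have h2 := h.ennrpow_const (1 / (2 : ENNReal).toReal)
    simpa using h2
  · filter_upwards [hle k] with x hx
    gcongr
    exact enorm_le_iff_norm_le.2 hx
  · filter_upwards [hlim] with x hx
    have h2 := (hx.enorm).ennrpow_const (2 : ENNReal).toReal
    simpa using h2

theorem tendsto_eLpNorm_sub_trans {f g : ℕ → X → F} {h : X → F}
    (hf : ∀ k, AEStronglyMeasurable (f k) μ) (hg : ∀ k, AEStronglyMeasurable (g k) μ)
    (hh : AEStronglyMeasurable h μ)
    (h1 : Tendsto (fun k => eLpNorm (fun x => f k x - g k x) 2 μ) atTop (𝓝 0))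
    (h2 : Tendsto (fun k => eLpNorm (fun x => g k x - h x) 2 μ) atTop (𝓝 0)) :
    Tendsto (fun k => eLpNorm (fun x => f k x - h x) 2 μ) atTop (𝓝 0) := by
  refine tendsto_of_tendsto_of_tendsto_of_le_of_le tendsto_const_nhds
    (by simpa using h1.add h2) (fun _ => zero_le) fun k => ?_
  have := eLpNorm_add_le ((hf k).sub (hg k)) ((hg k).sub hh) (p := 2) (by norm_num)
  refine le_trans (le_of_eq ?_) this
  congr 1
  ext x
  simp

theorem tendsto_eLpNorm_sub_sub {f g : ℕ → X → F} {f₀ g₀ : X → F}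
    (hf : ∀ k, AEStronglyMeasurable (f k) μ) (hg : ∀ k, AEStronglyMeasurable (g k) μ)
    (hf₀ : AEStronglyMeasurable f₀ μ) (hg₀ : AEStronglyMeasurable g₀ μ)
    (h1 : Tendsto (fun k => eLpNorm (fun x => f k x - f₀ x) 2 μ) atTop (𝓝 0))
    (h2 : Tendsto (fun k => eLpNorm (fun x => g k x - g₀ x) 2 μ) atTop (𝓝 0)) :
    Tendsto (fun k => eLpNorm (fun x => (f k x - g k x) - (f₀ x - g₀ x)) 2 μ) atTop (𝓝 0) := by
  refine tendsto_of_tendsto_of_tendsto_of_le_of_le tendsto_const_nhds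
    (by simpa using h1.add h2) (fun _ => zero_le) fun k => ?_
  have := eLpNorm_sub_le ((hf k).sub hf₀) ((hg k).sub hg₀) (p := 2) (by norm_num)
  refine le_trans (le_of_eq ?_) this
  congr 1
  ext x
  simp only [Pi.sub_apply]
  abel

theorem tendsto_eLpNorm_comp_lipschitz {f : ℕ → X → ℝ} {f₀ : X → ℝ} {β : ℝ → ℝ} {C : NNReal}
    (hβ : LipschitzWith C β)
    (h : Tendsto (fun k => eLpNorm (fun x => f k x - f₀ x) 2 μ) atTop (𝓝 0)) :
    Tendsto (fun k => eLpNorm (fun x => β (f k x) - β (f₀ x)) 2 μ) atTop (𝓝 0) := by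
  have h0 : Tendsto (fun k => (C : ENNReal) * eLpNorm (fun x => f k x - f₀ x) 2 μ) atTop (𝓝 0) := by
    simpa using ENNReal.Tendsto.const_mul h (Or.inr ENNReal.coe_ne_top)
  refine tendsto_of_tendsto_of_tendsto_of_le_of_le tendsto_const_nhds h0 (fun _ => zero_le)
    fun k => ?_
  refine (eLpNorm_le_nnreal_smul_eLpNorm_of_ae_le_mul (c := C)
    (Eventually.of_forall fun x => ?_) 2).trans (le_of_eq rfl)
  simpa [nndist_eq_nnnorm] using hβ.nndist_le (f k x) (f₀ x)

variable [NormedSpace ℝ F]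

/-- Split `a_k f_k - a₀ f₀ = a_k (f_k - f₀) + (a_k - a₀) f₀`: the uniform bound handles the first
term, dominated convergence the second. -/
theorem tendsto_eLpNorm_smul {a : ℕ → X → ℝ} {a₀ : X → ℝ} {f : ℕ → X → F} {f₀ : X → F}
    {C : NNReal} (ha : ∀ k, AEStronglyMeasurable (a k) μ) (ha₀ : AEStronglyMeasurable a₀ μ)
    (haC : ∀ k x, |a k x| ≤ C) (ha₀C : ∀ x, |a₀ x| ≤ C)
    (hf : ∀ k, AEStronglyMeasurable (f k) μ) (hf₀ : MemLp f₀ 2 μ)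
    (hlim : ∀ᵐ x ∂μ, Tendsto (fun k => a k x) atTop (𝓝 (a₀ x)))
    (h : Tendsto (fun k => eLpNorm (fun x => f k x - f₀ x) 2 μ) atTop (𝓝 0)) :
    Tendsto (fun k => eLpNorm (fun x => a k x • f k x - a₀ x • f₀ x) 2 μ) atTop (𝓝 0) := by
  refine tendsto_eLpNorm_sub_trans (g := fun k x => a k x • f₀ x) (fun k => (ha k).smul (hf k))
    (fun k => (ha k).smul hf₀.1) (ha₀.smul hf₀.1) ?_ ?_
  · have h0 : Tendsto (fun k => (C : ENNReal) * eLpNorm (fun x => f k x - f₀ x) 2 μ)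
        atTop (𝓝 0) := by
      simpa using ENNReal.Tendsto.const_mul h (Or.inr ENNReal.coe_ne_top)
    refine tendsto_of_tendsto_of_tendsto_of_le_of_le tendsto_const_nhds h0 (fun _ => zero_le)
      fun k => ?_
    refine (eLpNorm_le_nnreal_smul_eLpNorm_of_ae_le_mul (c := C)
      (Eventually.of_forall fun x => ?_) 2).trans (le_of_eq rfl)
    rw [← smul_sub, nnnorm_smul]
    gcongr
    exact haC k x
  · refine tendsto_eLpNorm_two_of_dominated (b := fun x => (2 * C : ℝ) * ‖f₀ x‖)
      (fun k => ((ha k).smul hf₀.1).sub (ha₀.smul hf₀.1)) (hf₀.norm.const_mul _) (fun k => ?_) ?_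
    · refine Eventually.of_forall fun x => ?_
      rw [← sub_smul, norm_smul, norm_mul, norm_norm, Real.norm_eq_abs]
      gcongr
      calc |a k x - a₀ x| ≤ |a k x| + |a₀ x| := abs_sub _ _
        _ ≤ 2 * C := by linarith [haC k x, ha₀C x]
        _ ≤ ‖(2 * C : ℝ)‖ := le_abs_self _
    · filter_upwards [hlim] with x hx
      simpa using (hx.smul_const (f₀ x)).sub_const (a₀ x • f₀ x)

end L2

variable {n : ℕ} {s : ℝ} {Ω : Set (EuclideanSpace ℝ (Fin n))}

/-! ### Gradients of smooth functions -/

local notation "E" n => EuclideanSpace ℝ (Fin n)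

theorem hasFDerivAt_slice_fst {φ : (E n) × ℝ → ℝ} {z : (E n) × ℝ} (h : DifferentiableAt ℝ φ z) :
    HasFDerivAt (fun x => φ (x, z.2))
      ((fderiv ℝ φ z).comp (ContinuousLinearMap.inl ℝ (E n) ℝ)) z.1 :=
  HasFDerivAt.comp z.1 (f := fun x => (x, z.2)) h.hasFDerivAt (hasFDerivAt_prodMk_left z.1 z.2)

theorem hasDerivAt_slice_snd {φ : (E n) × ℝ → ℝ} {z : (E n) × ℝ} (h : DifferentiableAt ℝ φ z) :
    HasDerivAt (fun y => φ (z.1, y)) (fderiv ℝ φ z (0, 1)) z.2 := by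
  have := (HasFDerivAt.comp z.2 (f := fun y => (z.1, y)) h.hasFDerivAt
    (hasFDerivAt_prodMk_right z.1 z.2)).hasDerivAt
  simp only [ContinuousLinearMap.comp_apply, ContinuousLinearMap.inr_apply] at this
  exact this

theorem gradX_eq {φ : (E n) × ℝ → ℝ} {z : (E n) × ℝ} (h : DifferentiableAt ℝ φ z) :
    gradX φ z = (InnerProductSpace.toDual ℝ (E n)).symm
      ((fderiv ℝ φ z).comp (ContinuousLinearMap.inl ℝ (E n) ℝ)) := by
  rw [gradX, gradient, (hasFDerivAt_slice_fst h).fderiv]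

theorem derivY_eq {φ : (E n) × ℝ → ℝ} {z : (E n) × ℝ} (h : DifferentiableAt ℝ φ z) :
    derivY φ z = fderiv ℝ φ z (0, 1) := (hasDerivAt_slice_snd h).deriv

theorem continuous_gradX {φ : (E n) × ℝ → ℝ} (h : ContDiff ℝ ((⊤ : ℕ∞) : WithTop ℕ∞) φ) :
    Continuous (gradX φ) := by
  have h1 : gradX φ = fun z => (InnerProductSpace.toDual ℝ (E n)).symm
      ((fderiv ℝ φ z).comp (ContinuousLinearMap.inl ℝ (E n) ℝ)) :=
    funext fun z => gradX_eq (h.differentiable (by simp) z)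
  rw [h1]
  have h2 := h.continuous_fderiv (by simp)
  exact (LinearIsometryEquiv.continuous _).comp (h2.clm_comp continuous_const)

theorem continuous_derivY {φ : (E n) × ℝ → ℝ} (h : ContDiff ℝ ((⊤ : ℕ∞) : WithTop ℕ∞) φ) :
    Continuous (derivY φ) := by
  have h1 : derivY φ = fun z => fderiv ℝ φ z (0, 1) :=
    funext fun z => derivY_eq (h.differentiable (by simp) z)
  rw [h1]
  exact (h.continuous_fderiv (by simp)).clm_apply continuous_const

theorem gradX_comp {φ : (E n) × ℝ → ℝ} {z : (E n) × ℝ} {β : ℝ → ℝ} {b : ℝ}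
    (h : DifferentiableAt ℝ φ z) (hβ : HasDerivAt β b (φ z)) :
    gradX (fun z => β (φ z)) z = b • gradX φ z := by
  have h1 := hβ.comp_hasFDerivAt z.1 (hasFDerivAt_slice_fst h)
  rw [gradX_eq h, gradX, gradient]
  erw [h1.fderiv]
  simp

theorem derivY_comp {φ : (E n) × ℝ → ℝ} {z : (E n) × ℝ} {β : ℝ → ℝ} {b : ℝ}
    (h : DifferentiableAt ℝ φ z) (hβ : HasDerivAt β b (φ z)) :
    derivY (fun z => β (φ z)) z = b * derivY φ z := by
  have h1 := hβ.comp z.2 (hasDerivAt_slice_snd h)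
  rw [derivY_eq h]
  exact h1.deriv

theorem gradX_sub {φ η : (E n) × ℝ → ℝ} {z : (E n) × ℝ}
    (h : DifferentiableAt ℝ φ z) (h' : DifferentiableAt ℝ η z) :
    gradX (fun z => φ z - η z) z = gradX φ z - gradX η z := by
  rw [gradX_eq h, gradX_eq h', gradX_eq (h.fun_sub h'), fderiv_fun_sub h h']
  simp [ContinuousLinearMap.sub_comp]

theorem derivY_sub {φ η : (E n) × ℝ → ℝ} {z : (E n) × ℝ}
    (h : DifferentiableAt ℝ φ z) (h' : DifferentiableAt ℝ η z) :
    derivY (fun z => φ z - η z) z = derivY φ z - derivY η z := by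
  rw [derivY_eq h, derivY_eq h', derivY_eq (h.fun_sub h'), fderiv_fun_sub h h']
  simp

/-! ### Limits in the energy norm -/

/-- The sequence `φ` converges, together with its gradient and its values on the base, to
`(w, G, g, u)` in the norm of the energy space. -/
structure EnergyLim (s : ℝ) (Ω : Set (E n)) (φ : ℕ → (E n) × ℝ → ℝ)
    (w : (E n) × ℝ → ℝ) (G : (E n) × ℝ → (E n)) (g : (E n) × ℝ → ℝ) (u : (E n) → ℝ) : Prop where
  smooth : ∀ k, ContDiff ℝ ((⊤ : ℕ∞) : WithTop ℕ∞) (φ k)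
  memLp : MemLp w 2 (cylMeasure s Ω)
  memLp_gradX : MemLp G 2 (cylMeasure s Ω)
  memLp_derivY : MemLp g 2 (cylMeasure s Ω)
  memLp_trace : MemLp u 2 ((gaussian n).restrict Ω)
  lim : Tendsto (fun k => eLpNorm (fun z => φ k z - w z) 2 (cylMeasure s Ω)) atTop (𝓝 0)
  lim_gradX : Tendsto (fun k => eLpNorm (fun z => gradX (φ k) z - G z) 2 (cylMeasure s Ω))
      atTop (𝓝 0)
  lim_derivY : Tendsto (fun k => eLpNorm (fun z => derivY (φ k) z - g z) 2 (cylMeasure s Ω))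
      atTop (𝓝 0)
  lim_trace : Tendsto (fun k => eLpNorm (fun x => φ k (x, 0) - u x) 2 ((gaussian n).restrict Ω))
      atTop (𝓝 0)

variable {φ η : ℕ → (E n) × ℝ → ℝ} {w w' : (E n) × ℝ → ℝ} {G G' : (E n) × ℝ → (E n)}
  {g g' : (E n) × ℝ → ℝ} {u u' : (E n) → ℝ}

theorem MemEnergy.exists_energyLim (h : MemEnergy s Ω w G g u) :
    ∃ φ, (∀ k, IsTest Ω (φ k)) ∧ EnergyLim s Ω φ w G g u := by
  obtain ⟨φ, h0, h1, h2, h3, h4⟩ := h.approx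
  exact ⟨φ, h0, fun k => (h0 k).1, h.1, h.2, h.3, h.4, h1, h2, h3, h4⟩

theorem EnergyLim.memEnergy (h : EnergyLim s Ω φ w G g u) (h0 : ∀ k, IsTest Ω (φ k)) :
    MemEnergy s Ω w G g u :=
  ⟨h.2, h.3, h.4, h.5, φ, h0, h.6, h.7, h.8, h.9⟩

theorem EnergyLim.aesm (h : EnergyLim s Ω φ w G g u) (k : ℕ) (μ : Measure ((E n) × ℝ)) :
    AEStronglyMeasurable (φ k) μ := (h.smooth k).continuous.aestronglyMeasurable

theorem EnergyLim.aesm_gradX (h : EnergyLim s Ω φ w G g u) (k : ℕ) (μ : Measure ((E n) × ℝ)) :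
    AEStronglyMeasurable (gradX (φ k)) μ := (continuous_gradX (h.smooth k)).aestronglyMeasurable

theorem EnergyLim.aesm_derivY (h : EnergyLim s Ω φ w G g u) (k : ℕ) (μ : Measure ((E n) × ℝ)) :
    AEStronglyMeasurable (derivY (φ k)) μ := (continuous_derivY (h.smooth k)).aestronglyMeasurable

theorem EnergyLim.aesm_trace (h : EnergyLim s Ω φ w G g u) (k : ℕ) (μ : Measure (E n)) :
    AEStronglyMeasurable (fun x => φ k (x, 0)) μ :=
  ((h.smooth k).continuous.comp (by fun_prop)).aestronglyMeasurable

theorem EnergyLim.sub (h : EnergyLim s Ω φ w G g u) (h' : EnergyLim s Ω η w' G' g' u') :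
    EnergyLim s Ω (fun k z => φ k z - η k z) (fun z => w z - w' z) (fun z => G z - G' z)
      (fun z => g z - g' z) (fun x => u x - u' x) := by
  have hd (k : ℕ) (z) := (h.smooth k).differentiable (by simp) z
  have hd' (k : ℕ) (z) := (h'.smooth k).differentiable (by simp) z
  refine ⟨fun k => (h.smooth k).sub (h'.smooth k), h.2.sub h'.2, h.3.sub h'.3, h.4.sub h'.4,
    h.5.sub h'.5, ?_, ?_, ?_, ?_⟩
  · exact tendsto_eLpNorm_sub_sub (fun k => h.aesm k _) (fun k => h'.aesm k _) h.2.1 h'.2.1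
      h.lim h'.lim
  · simp_rw [fun k z => gradX_sub (hd k z) (hd' k z)]
    exact tendsto_eLpNorm_sub_sub (fun k => h.aesm_gradX k _) (fun k => h'.aesm_gradX k _)
      h.3.1 h'.3.1 h.lim_gradX h'.lim_gradX
  · simp_rw [fun k z => derivY_sub (hd k z) (hd' k z)]
    exact tendsto_eLpNorm_sub_sub (fun k => h.aesm_derivY k _) (fun k => h'.aesm_derivY k _)
      h.4.1 h'.4.1 h.lim_derivY h'.lim_derivY
  · exact tendsto_eLpNorm_sub_sub (fun k => h.aesm_trace k _) (fun k => h'.aesm_trace k _)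
      h.5.1 h'.5.1 h.lim_trace h'.lim_trace

theorem EnergyLim.comp (h : EnergyLim s Ω φ w G g u) {k : ℕ → ℕ} (hk : Tendsto k atTop atTop) :
    EnergyLim s Ω (fun j => φ (k j)) w G g u :=
  ⟨fun j => h.1 (k j), h.2, h.3, h.4, h.5, h.6.comp hk, h.7.comp hk, h.8.comp hk, h.9.comp hk⟩

/-- The chain rule multiplies the gradients by a bounded continuous function of `φ k`; pointwise
convergence of that factor is what `tendsto_eLpNorm_smul` needs. -/
theorem EnergyLim.exists_subseq_ae (h : EnergyLim s Ω φ w G g u) :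
    ∃ k : ℕ → ℕ, Tendsto k atTop atTop ∧
      ∀ᵐ z ∂(cylMeasure s Ω), Tendsto (fun j => φ (k j) z) atTop (𝓝 (w z)) := by
  obtain ⟨k, hk, hk'⟩ := (tendstoInMeasure_of_tendsto_eLpNorm two_ne_zero (fun k => h.aesm k _)
    h.2.1 h.lim).exists_seq_tendsto_ae
  exact ⟨k, hk.tendsto_atTop, hk'⟩

/-- Membership of the truncated quadruple, for a fixed truncation. -/
theorem EnergyLim.trunc (h : EnergyLim s Ω φ w G g u)
    (hae : ∀ᵐ z ∂(cylMeasure s Ω), Tendsto (fun k => φ k z) atTop (𝓝 (w z))) (N : ℕ) :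
    EnergyLim s Ω (fun k z => trunc N (φ k z)) (fun z => trunc N (w z))
      (fun z => truncProfile ((N + 1) * w z) • G z) (fun z => truncProfile ((N + 1) * w z) • g z)
      (fun x => GaussOU.trunc N (u x)) := by
  obtain ⟨C, hC1, hC⟩ := exists_truncProfile_bound
  have hlip : LipschitzWith C (GaussOU.trunc N) := by
    refine lipschitzWith_of_nnnorm_deriv_le
      (fun t => (hasDerivAt_trunc N t).differentiableAt) fun t => ?_
    rw [(hasDerivAt_trunc N t).deriv]
    exact hC _
  have hd (k : ℕ) (z) := (h.smooth k).differentiable (by simp) z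
  have h0 : GaussOU.trunc N 0 = 0 := trunc_of_nonpos N le_rfl
  have hc : Continuous fun t : ℝ => truncProfile ((N + 1) * t) :=
    continuous_truncProfile.comp (by fun_prop)
  have hm : AEStronglyMeasurable (fun z => truncProfile ((N + 1) * w z)) (cylMeasure s Ω) :=
    hc.comp_aestronglyMeasurable h.2.1
  have hb : MemLp (fun z => truncProfile ((N + 1) * w z)) ⊤ (cylMeasure s Ω) :=
    memLp_top_of_bound hm C (Eventually.of_forall fun z => hC _)
  have hma (k : ℕ) : AEStronglyMeasurable (fun z => truncProfile ((N + 1) * φ k z))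
      (cylMeasure s Ω) := hc.comp_aestronglyMeasurable (h.aesm k _)
  have hlim : ∀ᵐ z ∂(cylMeasure s Ω), Tendsto (fun j => truncProfile ((N + 1) * φ j z)) atTop
      (𝓝 (truncProfile ((N + 1) * w z))) := by
    filter_upwards [hae] with z hz
    exact (hc.tendsto _).comp hz
  refine ⟨fun k => (contDiff_trunc N).comp (h.smooth k), hlip.comp_memLp h0 h.2,
    h.3.smul hb, h.4.smul hb, hlip.comp_memLp h0 h.5, ?_, ?_, ?_, ?_⟩
  · exact tendsto_eLpNorm_comp_lipschitz hlip h.lim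
  · simp_rw [fun k z => gradX_comp (hd k z) (hasDerivAt_trunc N (φ k z))]
    exact tendsto_eLpNorm_smul hma hm (fun _ _ => hC _) (fun _ => hC _)
      (fun k => h.aesm_gradX k _) h.3 hlim h.lim_gradX
  · simp_rw [fun k z => derivY_comp (hd k z) (hasDerivAt_trunc N (φ k z))]
    exact tendsto_eLpNorm_smul hma hm (fun _ _ => hC _) (fun _ => hC _)
      (fun k => h.aesm_derivY k _) h.4 hlim h.lim_derivY
  · exact tendsto_eLpNorm_comp_lipschitz hlip h.lim_trace

theorem tendsto_eLpNorm_trunc_sub {X : Type*} [MeasurableSpace X] {μ : Measure X} {f : X → ℝ}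
    (hf : MemLp f 2 μ) :
    Tendsto (fun N => eLpNorm (fun x => trunc N (f x) - max (f x) 0) 2 μ) atTop (𝓝 0) := by
  refine tendsto_eLpNorm_two_of_dominated (fun N => ?_) hf
    (fun N => Eventually.of_forall fun x => abs_trunc_sub_le N (f x))
    (Eventually.of_forall fun x => by simpa using (tendsto_trunc (f x)).sub_const (max (f x) 0))
  exact ((contDiff_trunc N).continuous.comp_aestronglyMeasurable hf.1).sub
    (hf.1.sup aestronglyMeasurable_const)

/-- Energy limits are stable under passing to the positive part. -/
theorem EnergyLim.exists_pos (h : EnergyLim s Ω φ w G g u) :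
    ∃ k : ℕ → ℕ, EnergyLim s Ω (fun N z => GaussOU.trunc N (φ (k N) z)) (fun z => max (w z) 0)
      (fun z => posInd (w z) • G z) (fun z => posInd (w z) • g z) (fun x => max (u x) 0) := by
  obtain ⟨k₀, hk₀, hae⟩ := h.exists_subseq_ae
  have h' := h.comp hk₀
  have hT (N : ℕ) := h'.trunc hae N
  -- Diagonal choice: for each truncation level `N`, one approximant whose four errors are all at
  -- most `1 / (N + 1)`.
  have hex (N : ℕ) : ∃ j,
      eLpNorm (fun z => GaussOU.trunc N (φ (k₀ j) z) - GaussOU.trunc N (w z)) 2 (cylMeasure s Ω)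
        ≤ ((N : ENNReal) + 1)⁻¹ ∧
      eLpNorm (fun z => gradX (fun z => GaussOU.trunc N (φ (k₀ j) z)) z
        - truncProfile ((N + 1) * w z) • G z) 2 (cylMeasure s Ω) ≤ ((N : ENNReal) + 1)⁻¹ ∧
      eLpNorm (fun z => derivY (fun z => GaussOU.trunc N (φ (k₀ j) z)) z
        - truncProfile ((N + 1) * w z) • g z) 2 (cylMeasure s Ω) ≤ ((N : ENNReal) + 1)⁻¹ ∧
      eLpNorm (fun x => GaussOU.trunc N (φ (k₀ j) (x, 0)) - GaussOU.trunc N (u x)) 2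
        ((gaussian n).restrict Ω) ≤ ((N : ENNReal) + 1)⁻¹ := by
    have hpos : (0 : ENNReal) < ((N : ENNReal) + 1)⁻¹ := by
      rw [ENNReal.inv_pos]; exact ENNReal.add_ne_top.2 ⟨ENNReal.natCast_ne_top N, by simp⟩
    exact (((hT N).lim.eventually_le_const hpos).and
      (((hT N).lim_gradX.eventually_le_const hpos).and
      (((hT N).lim_derivY.eventually_le_const hpos).and
      ((hT N).lim_trace.eventually_le_const hpos)))).exists
  choose j hj1 hj2 hj3 hj4 using hex
  have hinv : Tendsto (fun N : ℕ => ((N : ENNReal) + 1)⁻¹) atTop (𝓝 0) := by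
    have := (tendsto_add_atTop_iff_nat 1).2 ENNReal.tendsto_inv_nat_nhds_zero
    simpa using this
  have squeeze {a : ℕ → ENNReal} (ha : ∀ N, a N ≤ ((N : ENNReal) + 1)⁻¹) :
      Tendsto a atTop (𝓝 0) :=
    tendsto_of_tendsto_of_tendsto_of_le_of_le tendsto_const_nhds hinv (fun _ => zero_le) ha
  obtain ⟨C, hC1, hC⟩ := exists_truncProfile_bound
  have hpm : AEStronglyMeasurable (fun z => posInd (w z)) (cylMeasure s Ω) :=
    (measurable_posInd.comp_aemeasurable h.2.1.aemeasurable).aestronglyMeasurable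
  have hpb (z) : |posInd (w z)| ≤ C := (abs_posInd_le _).trans hC1
  have hb : MemLp (fun z => posInd (w z)) ⊤ (cylMeasure s Ω) :=
    memLp_top_of_bound hpm C (Eventually.of_forall hpb)
  have hma (N : ℕ) : AEStronglyMeasurable (fun z => truncProfile ((N + 1) * w z))
      (cylMeasure s Ω) :=
    (continuous_truncProfile.comp (by fun_prop : Continuous fun t : ℝ => ((N : ℝ) + 1) * t))
      |>.comp_aestronglyMeasurable h.2.1
  have hlim : ∀ᵐ z ∂(cylMeasure s Ω), Tendsto (fun N : ℕ => truncProfile ((N + 1) * w z)) atTop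
      (𝓝 (posInd (w z))) := Eventually.of_forall fun z => tendsto_truncProfile _
  have hsm (N : ℕ) := (hT N).smooth (j N)
  refine ⟨fun N => k₀ (j N), hsm, h.2.sup (MemLp.zero' (p := 2)), h.3.smul hb, h.4.smul hb,
    h.5.sup (MemLp.zero' (p := 2)), ?_, ?_, ?_, ?_⟩
  · exact tendsto_eLpNorm_sub_trans (g := fun N z => GaussOU.trunc N (w z))
      (fun N => (hT N).aesm (j N) _) (fun N => (hT N).2.1)
      (h.2.sup (MemLp.zero' (p := 2))).1 (squeeze hj1) (tendsto_eLpNorm_trunc_sub h.2)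
  -- After the diagonal error, only the factor in front of the fixed field `G` varies, so the
  -- product lemma applies with a constant sequence.
  · exact tendsto_eLpNorm_sub_trans (fun N => (hT N).aesm_gradX (j N) _) (fun N => (hT N).3.1)
      (h.3.smul hb (r := 2)).1 (squeeze hj2)
      (tendsto_eLpNorm_smul hma hpm (fun _ _ => hC _) hpb (fun _ => h.3.1) h.3 hlim (by simp))
  · exact tendsto_eLpNorm_sub_trans (fun N => (hT N).aesm_derivY (j N) _) (fun N => (hT N).4.1)
      (h.4.smul hb (r := 2)).1 (squeeze hj3)
      (tendsto_eLpNorm_smul hma hpm (fun _ _ => hC _) hpb (fun _ => h.4.1) h.4 hlim (by simp))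
  · exact tendsto_eLpNorm_sub_trans (g := fun N x => GaussOU.trunc N (u x))
      (fun N => (hT N).aesm_trace (j N) _) (fun N => (hT N).5.1)
      (h.5.sup (MemLp.zero' (p := 2))).1 (squeeze hj4) (tendsto_eLpNorm_trunc_sub h.5)

/-! ### Test functions -/

theorem IsTest.mono {Ω' : Set (E n)} {f : (E n) × ℝ → ℝ} (h : IsTest Ω f) (hΩ : Ω ⊆ Ω') :
    IsTest Ω' f :=
  ⟨h.1, h.2.1, h.2.2.trans (prod_mono hΩ subset_rfl)⟩

theorem IsTest.sub {f₁ f₂ : (E n) × ℝ → ℝ} (h₁ : IsTest Ω f₁) (h₂ : IsTest Ω f₂) :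
    IsTest Ω (fun z => f₁ z - f₂ z) :=
  ⟨h₁.1.sub h₂.1, h₁.2.1.sub h₂.2.1,
    (tsupport_sub f₁ f₂).trans (union_subset h₁.2.2 h₂.2.2)⟩

/-- Where `f₁ = 0` the difference is nonpositive and the truncation kills it, so the support lies in
that of `f₁`. Hence `f₂` may be nonzero on the lateral boundary, as happens when it comes from the
larger cylinder. -/
theorem IsTest.trunc_sub {f₁ f₂ : (E n) × ℝ → ℝ} (h₁ : IsTest Ω f₁)
    (h₂ : ContDiff ℝ ((⊤ : ℕ∞) : WithTop ℕ∞) f₂) (hf₂ : ∀ z, 0 ≤ f₂ z) (N : ℕ) :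
    IsTest Ω (fun z => trunc N (f₁ z - f₂ z)) := by
  have hs : Function.support (fun z => trunc N (f₁ z - f₂ z)) ⊆ Function.support f₁ := by
    intro z hz hz'
    exact hz (trunc_of_nonpos N (by rw [hz']; linarith [hf₂ z]))
  exact ⟨(contDiff_trunc N).comp (h₁.1.sub h₂), h₁.2.1.mono hs, (closure_mono hs).trans h₁.2.2⟩

theorem IsTest.trunc {f : (E n) × ℝ → ℝ} (h : IsTest Ω f) (N : ℕ) :
    IsTest Ω (fun z => GaussOU.trunc N (f z)) := by
  simpa using h.trunc_sub (f₂ := fun _ => 0) contDiff_const (fun _ => le_rfl) N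

theorem MemEnergy.sub (h : MemEnergy s Ω w G g u) (h' : MemEnergy s Ω w' G' g' u') :
    MemEnergy s Ω (fun z => w z - w' z) (fun z => G z - G' z)
      (fun z => g z - g' z) (fun x => u x - u' x) := by
  obtain ⟨φ, hφ, hl⟩ := h.exists_energyLim
  obtain ⟨η, hη, hl'⟩ := h'.exists_energyLim
  exact (hl.sub hl').memEnergy fun k => (hφ k).sub (hη k)

theorem MemEnergy.exists_pos (h : MemEnergy s Ω w G g u) :
    ∃ φ, (∀ k, IsTest Ω (φ k)) ∧ (∀ k z, 0 ≤ φ k z) ∧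
      EnergyLim s Ω φ (fun z => max (w z) 0)
      (fun z => posInd (w z) • G z) (fun z => posInd (w z) • g z) (fun x => max (u x) 0) := by
  obtain ⟨φ, hφ, hl⟩ := h.exists_energyLim
  obtain ⟨k, hk⟩ := hl.exists_pos
  exact ⟨_, fun N => (hφ _).trunc N, fun N z => trunc_nonneg N _, hk⟩

/-! ### The trace inequality -/

instance sFinite_gaussian : SFinite (gaussian n) := by
  unfold gaussian; infer_instance

/-- The measure `y^a dy` on `(0, ∞)`, `a = 1 - 2s`. -/
noncomputable def weight (s : ℝ) : Measure ℝ :=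
  (volume.restrict (Ioi (0 : ℝ))).withDensity fun y => ENNReal.ofReal (y ^ (1 - 2 * s))

instance sFinite_weight : SFinite (weight s) := by
  unfold weight; infer_instance

theorem cylMeasure_eq : cylMeasure s Ω = ((gaussian n).restrict Ω).prod (weight s) := rfl

/-- Integrate the derivative of `(1 - y/R) f(y)` over `[0, R]`: the cutoff is `1` at `0`, vanishes
at `R` and stays between `0` and `1`. -/
theorem enorm_le_lintegral_of_smooth {f : ℝ → ℝ} (hf : ContDiff ℝ 1 f) {R : ℝ} (hR : 0 < R) :
    ‖f 0‖ₑ ≤ ∫⁻ y in Ioc 0 R, ‖R⁻¹ * ‖f y‖ + ‖deriv f y‖‖ₑ := by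
  have hd (y : ℝ) : HasDerivAt (fun y => (1 - R⁻¹ * y) * f y)
      (-R⁻¹ * f y + (1 - R⁻¹ * y) * deriv f y) y := by
    have h1 : HasDerivAt (fun y : ℝ => 1 - R⁻¹ * y) (-R⁻¹) y := by
      simpa using ((hasDerivAt_id y).const_mul R⁻¹).const_sub 1
    exact h1.mul (hf.differentiable (by simp) y).hasDerivAt
  have hcont : Continuous fun y => -R⁻¹ * f y + (1 - R⁻¹ * y) * deriv f y := by
    have := hf.continuous
    have := hf.continuous_deriv (by simp)
    fun_prop
  have hftc := intervalIntegral.integral_eq_sub_of_hasDerivAt (a := 0) (b := R)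
    (fun y _ => hd y) (hcont.intervalIntegrable _ _)
  rw [intervalIntegral.integral_of_le hR.le, inv_mul_cancel₀ hR.ne'] at hftc
  have hval : f 0 = -∫ y in Ioc 0 R, (-R⁻¹ * f y + (1 - R⁻¹ * y) * deriv f y) := by
    rw [hftc]; simp
  rw [hval, enorm_neg]
  refine (enorm_integral_le_lintegral_enorm _).trans
    (setLIntegral_mono' measurableSet_Ioc fun y hy => ?_)
  have h1 : R⁻¹ * y ≤ 1 := by
    rw [inv_mul_le_iff₀ hR]; simpa using hy.2
  have h0 : 0 ≤ R⁻¹ * y := mul_nonneg (inv_nonneg.2 hR.le) hy.1.le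
  refine enorm_le_iff_norm_le.2 ?_
  rw [Real.norm_of_nonneg (r := R⁻¹ * ‖f y‖ + ‖deriv f y‖) (by positivity)]
  refine (norm_add_le _ _).trans (add_le_add ?_ ?_)
  · rw [norm_mul, norm_neg, Real.norm_of_nonneg (inv_nonneg.2 hR.le)]
  · rw [norm_mul]
    refine mul_le_of_le_one_left (norm_nonneg _) ?_
    rw [Real.norm_eq_abs, abs_le]
    constructor <;> linarith

theorem lintegral_rpow_Ioc (hs : 0 < s) {R : ℝ} (hR : 0 < R) :
    ∫⁻ y in Ioc 0 R, ENNReal.ofReal (y ^ (2 * s - 1)) = ENNReal.ofReal (R ^ (2 * s) / (2 * s)) := by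
  have hint : IntervalIntegrable (fun y : ℝ => y ^ (2 * s - 1)) volume 0 R :=
    intervalIntegral.intervalIntegrable_rpow' (by linarith)
  rw [← ofReal_integral_eq_lintegral_ofReal
    ((intervalIntegrable_iff_integrableOn_Ioc_of_le hR.le).1 hint),
    ← intervalIntegral.integral_of_le hR.le, integral_rpow (Or.inl (by linarith))]
  · simp only [sub_add_cancel]
    rw [Real.zero_rpow (by positivity), sub_zero]
  · filter_upwards [ae_restrict_mem measurableSet_Ioc] with y hy
    exact Real.rpow_nonneg hy.1.le _

/-- Cauchy–Schwarz after writing `1 = y^(s-1/2) y^(1/2-s)`: the squares are `y^(2s-1)`, integrable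
at `0` since `s > 0`, and the weight `y^(1-2s)`. -/
theorem lintegral_Ioc_le_weight (hs : 0 < s) {R : ℝ} (hR : 0 < R) {B : ℝ → ENNReal}
    (hB : Measurable B) :
    ∫⁻ y in Ioc 0 R, B y ≤ ENNReal.ofReal (R ^ (2 * s) / (2 * s)) ^ (1 / 2 : ℝ)
      * (∫⁻ y, B y ^ (2 : ℝ) ∂(weight s)) ^ (1 / 2 : ℝ) := by
  have hm : Measurable fun y : ℝ => ENNReal.ofReal (y ^ (s - 1 / 2)) := by fun_prop
  have hm' : Measurable fun y : ℝ => ENNReal.ofReal (y ^ (1 / 2 - s)) * B y := by fun_prop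
  have hH := ENNReal.lintegral_mul_le_Lp_mul_Lq (volume.restrict (Ioc 0 R))
    Real.HolderConjugate.two_two hm.aemeasurable hm'.aemeasurable
  have hl : ∫⁻ y in Ioc 0 R, B y = ∫⁻ y in Ioc 0 R, ((fun y : ℝ => ENNReal.ofReal (y ^ (s - 1 / 2)))
      * fun y => ENNReal.ofReal (y ^ (1 / 2 - s)) * B y) y := by
    refine setLIntegral_congr_fun measurableSet_Ioc fun y hy => ?_
    simp only [Pi.mul_apply]
    rw [← mul_assoc, ← ENNReal.ofReal_mul (Real.rpow_nonneg hy.1.le _), ← Real.rpow_add hy.1]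
    simp
  have h1 : ∫⁻ y in Ioc 0 R, ENNReal.ofReal (y ^ (s - 1 / 2)) ^ (2 : ℝ)
      = ENNReal.ofReal (R ^ (2 * s) / (2 * s)) := by
    rw [← lintegral_rpow_Ioc hs hR]
    refine setLIntegral_congr_fun measurableSet_Ioc fun y hy => ?_
    rw [ENNReal.ofReal_rpow_of_nonneg (Real.rpow_nonneg hy.1.le _) (by norm_num),
      ← Real.rpow_mul hy.1.le]
    ring_nf
  have h2 : ∫⁻ y in Ioc 0 R, (ENNReal.ofReal (y ^ (1 / 2 - s)) * B y) ^ (2 : ℝ)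
      ≤ ∫⁻ y, B y ^ (2 : ℝ) ∂(weight s) := by
    rw [weight, lintegral_withDensity_eq_lintegral_mul _ (by fun_prop) (by fun_prop)]
    refine le_trans (le_of_eq ?_) (lintegral_mono_set (Ioc_subset_Ioi_self : Ioc 0 R ⊆ Ioi 0))
    refine setLIntegral_congr_fun measurableSet_Ioc fun y hy => ?_
    simp only [Pi.mul_apply]
    rw [ENNReal.mul_rpow_of_nonneg _ _ (by norm_num),
      ENNReal.ofReal_rpow_of_nonneg (Real.rpow_nonneg hy.1.le _) (by norm_num),
      ← Real.rpow_mul hy.1.le]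
    ring_nf
  rw [hl]
  refine hH.trans ?_
  rw [h1]
  gcongr

/-- The height `R` is left free: the coefficient of `‖f‖` is of order `R^(s-1)`, which can be made
small. -/
theorem eLpNorm_trace_le (hs : 0 < s) {f : (E n) × ℝ → ℝ}
    (hf : ContDiff ℝ ((⊤ : ℕ∞) : WithTop ℕ∞) f) {R : ℝ} (hR : 0 < R) :
    eLpNorm (fun x => f (x, 0)) 2 ((gaussian n).restrict Ω) ≤
      ENNReal.ofReal (R ^ (2 * s) / (2 * s)) ^ (1 / 2 : ℝ)
        * (ENNReal.ofReal R⁻¹ * eLpNorm f 2 (cylMeasure s Ω)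
          + eLpNorm (derivY f) 2 (cylMeasure s Ω)) := by
  set K := ENNReal.ofReal (R ^ (2 * s) / (2 * s)) with hK
  have hcf := hf.continuous
  have hcd := continuous_derivY hf
  let b : (E n) × ℝ → ℝ := fun z => R⁻¹ * ‖f z‖ + ‖derivY f z‖
  have hb : Measurable b := by
    have : Continuous b := by fun_prop
    exact this.measurable
  have hpt (x : E n) : ‖f (x, 0)‖ₑ ^ (2 : ℝ) ≤ K * ∫⁻ y, ‖b (x, y)‖ₑ ^ (2 : ℝ) ∂(weight s) := by
    have h1 := enorm_le_lintegral_of_smooth (f := fun y => f (x, y))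
      ((hf.comp (contDiff_prodMk_right x)).of_le (by exact_mod_cast le_top)) hR
    have h2 := h1.trans (lintegral_Ioc_le_weight hs hR (B := fun y => ‖b (x, y)‖ₑ)
      (hb.comp measurable_prodMk_left).enorm)
    calc ‖f (x, 0)‖ₑ ^ (2 : ℝ) ≤ (K ^ (1 / 2 : ℝ)
          * (∫⁻ y, ‖b (x, y)‖ₑ ^ (2 : ℝ) ∂(weight s)) ^ (1 / 2 : ℝ)) ^ (2 : ℝ) := by gcongr
      _ = _ := by
        rw [ENNReal.mul_rpow_of_nonneg _ _ (by norm_num), ← ENNReal.rpow_mul, ← ENNReal.rpow_mul]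
        norm_num
  have hsq : eLpNorm (fun x => f (x, 0)) 2 ((gaussian n).restrict Ω)
      ≤ K ^ (1 / 2 : ℝ) * eLpNorm b 2 (cylMeasure s Ω) := by
    rw [eLpNorm_eq_lintegral_rpow_enorm_toReal two_ne_zero ENNReal.ofNat_ne_top,
      eLpNorm_eq_lintegral_rpow_enorm_toReal two_ne_zero ENNReal.ofNat_ne_top,
      ENNReal.toReal_ofNat, ← ENNReal.mul_rpow_of_nonneg _ _ (by norm_num)]
    gcongr
    rw [cylMeasure_eq, lintegral_prod _ (by fun_prop), ← lintegral_const_mul' _ _ (by simp [hK])]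
    exact lintegral_mono fun x => hpt x
  refine hsq.trans ?_
  gcongr
  have h3 := eLpNorm_add_le (μ := cylMeasure s Ω) (f := fun z => R⁻¹ * ‖f z‖)
    (g := fun z => ‖derivY f z‖) (p := 2)
    (by have : Continuous fun z => R⁻¹ * ‖f z‖ := by fun_prop
        exact this.aestronglyMeasurable)
    hcd.norm.aestronglyMeasurable (by norm_num)
  refine h3.trans (le_of_eq ?_)
  congr 1
  · have := eLpNorm_const_smul (R⁻¹) (fun z => ‖f z‖) 2 (cylMeasure s Ω)
    rw [eLpNorm_norm, Real.enorm_of_nonneg (inv_nonneg.2 hR.le)] at this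
    exact this
  · exact eLpNorm_norm _

/-- With `g = 0` the trace inequality reads `‖u‖ ≤ (2s)^(-1/2) R^(s-1) ‖w‖` for every `R > 0`; let
`R → ∞`, using `s < 1`. -/
theorem EnergyLim.trace_ae_eq_zero (hs0 : 0 < s) (hs1 : s < 1) (h : EnergyLim s Ω φ w G g u)
    (hg : g =ᵐ[cylMeasure s Ω] 0) : u =ᵐ[(gaussian n).restrict Ω] 0 := by
  set μ := cylMeasure s Ω
  set ν := (gaussian n).restrict Ω
  have key {R : ℝ} (hR : 0 < R) : eLpNorm u 2 ν ≤
      ENNReal.ofReal ((2 * s) ^ (-(1 / 2) : ℝ) * R ^ (-(1 - s))) * eLpNorm w 2 μ := by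
    set K := ENNReal.ofReal (R ^ (2 * s) / (2 * s)) ^ (1 / 2 : ℝ) with hK
    have hKtop : K ≠ ⊤ := ENNReal.rpow_ne_top_of_nonneg (by norm_num) ENNReal.ofReal_ne_top
    have hKR : K * ENNReal.ofReal R⁻¹
        = ENNReal.ofReal ((2 * s) ^ (-(1 / 2) : ℝ) * R ^ (-(1 - s))) := by
      rw [hK, ENNReal.ofReal_rpow_of_nonneg (by positivity) (by norm_num),
        ← ENNReal.ofReal_mul (by positivity)]
      congr 1
      rw [Real.div_rpow (by positivity) (by positivity), ← Real.rpow_mul hR.le,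
        Real.rpow_neg (by positivity), show -(1 - s) = 2 * s * (1 / 2) + (-1) by ring,
        Real.rpow_add hR, Real.rpow_neg_one]
      ring
    -- The trace inequality is available only for the smooth approximants, so it is applied to `φ k`
    -- and passed to the limit.
    have hle (k : ℕ) : eLpNorm u 2 ν ≤ eLpNorm (fun x => φ k (x, 0) - u x) 2 ν
        + K * (ENNReal.ofReal R⁻¹ * (eLpNorm (fun z => φ k z - w z) 2 μ + eLpNorm w 2 μ)
          + eLpNorm (fun z => derivY (φ k) z - g z) 2 μ) := by
      have h1 : eLpNorm u 2 ν ≤ eLpNorm (fun x => φ k (x, 0) - u x) 2 ν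
          + eLpNorm (fun x => φ k (x, 0)) 2 ν := by
        have := eLpNorm_sub_le (h.aesm_trace k ν) ((h.aesm_trace k ν).sub h.5.1) (p := 2)
          (by norm_num)
        rw [add_comm]
        refine le_trans (le_of_eq ?_) this
        congr 1; ext x; simp
      have h2 : eLpNorm (φ k) 2 μ ≤ eLpNorm (fun z => φ k z - w z) 2 μ + eLpNorm w 2 μ := by
        have := eLpNorm_add_le ((h.aesm k μ).sub h.2.1) h.2.1 (p := 2) (by norm_num)
        refine le_trans (le_of_eq ?_) this
        congr 1; ext x; simp
      have h3 : eLpNorm (derivY (φ k)) 2 μ = eLpNorm (fun z => derivY (φ k) z - g z) 2 μ := by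
        refine eLpNorm_congr_ae ?_
        filter_upwards [hg] with z hz
        simp [hz]
      refine h1.trans ?_
      gcongr
      refine (eLpNorm_trace_le hs0 (h.smooth k) hR).trans ?_
      rw [← hK, h3]
      gcongr
    have hlim : Tendsto (fun k => eLpNorm (fun x => φ k (x, 0) - u x) 2 ν
        + K * (ENNReal.ofReal R⁻¹ * (eLpNorm (fun z => φ k z - w z) 2 μ + eLpNorm w 2 μ)
          + eLpNorm (fun z => derivY (φ k) z - g z) 2 μ)) atTop
        (𝓝 (0 + K * (ENNReal.ofReal R⁻¹ * (0 + eLpNorm w 2 μ) + 0))) :=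
      h.lim_trace.add (ENNReal.Tendsto.const_mul ((ENNReal.Tendsto.const_mul
        (h.lim.add tendsto_const_nhds) (Or.inr ENNReal.ofReal_ne_top)).add h.lim_derivY)
        (Or.inr hKtop))
    have := ge_of_tendsto' hlim hle
    rwa [zero_add, zero_add, add_zero, ← mul_assoc, hKR] at this
  have hzero : eLpNorm u 2 ν ≤ 0 := by
    have ht : Tendsto (fun R : ℝ => ENNReal.ofReal ((2 * s) ^ (-(1 / 2) : ℝ) * R ^ (-(1 - s)))
        * eLpNorm w 2 μ) atTop (𝓝 0) := by
      have h1 : Tendsto (fun R : ℝ => (2 * s) ^ (-(1 / 2) : ℝ) * R ^ (-(1 - s))) atTop (𝓝 0) := by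
        simpa using (tendsto_rpow_neg_atTop (by linarith : 0 < 1 - s)).const_mul
          ((2 * s) ^ (-(1 / 2) : ℝ))
      have h2 := ENNReal.Tendsto.mul_const (ENNReal.tendsto_ofReal h1)
        (Or.inr h.2.eLpNorm_ne_top)
      simpa using h2
    refine ge_of_tendsto ht ?_
    filter_upwards [eventually_gt_atTop (0 : ℝ)] with R hR using key hR
  exact (eLpNorm_eq_zero_iff h.5.1 two_ne_zero).1 (le_antisymm hzero zero_le)

/-! ### Change of domain -/

theorem cylMeasure_eq_restrict {Ω' : Set (E n)} (hΩ : Ω ⊆ Ω') (hm : MeasurableSet Ω) :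
    cylMeasure s Ω = (cylMeasure s Ω').restrict (Ω ×ˢ univ) := by
  rw [cylMeasure_eq, cylMeasure_eq, ← Measure.prod_restrict, Measure.restrict_univ,
    Measure.restrict_restrict hm, inter_eq_left.2 hΩ]

/-- Restriction to a smaller cylinder loses the lateral boundary condition, so the conclusion is
only an `EnergyLim`, not a `MemEnergy`. -/
theorem EnergyLim.restrict {Ω' : Set (E n)} (h : EnergyLim s Ω' φ w G g u) (hΩ : Ω ⊆ Ω')
    (hm : MeasurableSet Ω) : EnergyLim s Ω φ w G g u := by
  have hc : cylMeasure s Ω ≤ cylMeasure s Ω' := by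
    rw [cylMeasure_eq_restrict hΩ hm]; exact Measure.restrict_le_self
  have hg : (gaussian n).restrict Ω ≤ (gaussian n).restrict Ω' := Measure.restrict_mono_set _ hΩ
  have squeeze {a b : ℕ → ENNReal} (hb : Tendsto b atTop (𝓝 0)) (ha : ∀ k, a k ≤ b k) :
      Tendsto a atTop (𝓝 0) :=
    tendsto_of_tendsto_of_tendsto_of_le_of_le tendsto_const_nhds hb (fun _ => zero_le) ha
  exact ⟨h.1, h.2.mono_measure hc, h.3.mono_measure hc, h.4.mono_measure hc,
    h.5.mono_measure hg, squeeze h.6 fun _ => eLpNorm_mono_measure _ hc,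
    squeeze h.7 fun _ => eLpNorm_mono_measure _ hc,
    squeeze h.8 fun _ => eLpNorm_mono_measure _ hc,
    squeeze h.9 fun _ => eLpNorm_mono_measure _ hg⟩

theorem eLpNorm_sub_indicator {X F : Type*} [MeasurableSpace X] [NormedAddCommGroup F]
    {μ : Measure X} {S : Set X} (hS : MeasurableSet S) {f g : X → F} (hf : ∀ x ∉ S, f x = 0) :
    eLpNorm (fun x => f x - S.indicator g x) 2 μ
      = eLpNorm (fun x => f x - g x) 2 (μ.restrict S) := by
  rw [← eLpNorm_indicator_eq_eLpNorm_restrict hS]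
  congr 1
  ext x
  by_cases hx : x ∈ S <;> simp [hx, hf]

theorem IsTest.gradX_eq_zero {f : (E n) × ℝ → ℝ} (h : IsTest Ω f) {z : (E n) × ℝ}
    (hz : z ∉ Ω ×ˢ (univ : Set ℝ)) : f z = 0 ∧ gradX f z = 0 ∧ derivY f z = 0 := by
  have hz' : z ∉ tsupport f := fun h' => hz (h.2.2 h')
  have hd := h.1.differentiable (by simp) z
  have h0 : fderiv ℝ f z = 0 := by
    by_contra hne
    exact hz' (support_fderiv_subset ℝ hne)
  refine ⟨image_eq_zero_of_notMem_tsupport hz', ?_, ?_⟩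
  · rw [gradX_eq hd, h0]; simp
  · rw [derivY_eq hd, h0]; simp

/-- Extension by zero to a larger domain. -/
theorem MemEnergy.extend {Ω' : Set (E n)} (h : MemEnergy s Ω w G g u) (hΩ : Ω ⊆ Ω')
    (hm : MeasurableSet Ω) :
    MemEnergy s Ω' ((Ω ×ˢ univ).indicator w) ((Ω ×ˢ univ).indicator G)
      ((Ω ×ˢ univ).indicator g) (Ω.indicator u) := by
  have hS : MeasurableSet (Ω ×ˢ (univ : Set ℝ)) := hm.prod MeasurableSet.univ
  have hr : (gaussian n).restrict Ω = ((gaussian n).restrict Ω').restrict Ω := by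
    rw [Measure.restrict_restrict hm, inter_eq_left.2 hΩ]
  obtain ⟨φ, hφ, hl⟩ := h.exists_energyLim
  obtain ⟨-, h2, h3, h4, h5, h6, h7, h8, h9⟩ := hl
  rw [cylMeasure_eq_restrict hΩ hm] at h2 h3 h4 h6 h7 h8
  rw [hr] at h5 h9
  -- The same approximants serve: they and their gradients vanish off `Ω × ℝ`, so no error is added
  -- on the larger cylinder.
  refine ⟨(memLp_indicator_iff_restrict hS).2 h2, (memLp_indicator_iff_restrict hS).2 h3,
    (memLp_indicator_iff_restrict hS).2 h4, (memLp_indicator_iff_restrict hm).2 h5,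
    φ, fun k => (hφ k).mono hΩ, ?_, ?_, ?_, ?_⟩
  · simpa only [eLpNorm_sub_indicator hS fun z hz => ((hφ _).gradX_eq_zero hz).1] using h6
  · simpa only [eLpNorm_sub_indicator hS fun z hz => ((hφ _).gradX_eq_zero hz).2.1] using h7
  · simpa only [eLpNorm_sub_indicator hS fun z hz => ((hφ _).gradX_eq_zero hz).2.2] using h8
  · simpa only [eLpNorm_sub_indicator hm (f := fun x => φ _ (x, 0)) fun x hx =>
      ((hφ _).gradX_eq_zero (z := (x, 0)) fun h' => hx h'.1).1] using h9

/-! ### The weak maximum principle -/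

theorem integrable_energy {μ : Measure ((E n) × ℝ)} (hG : MemLp G 2 μ) (hg : MemLp g 2 μ)
    (hG' : MemLp G' 2 μ) (hg' : MemLp g' 2 μ) :
    Integrable (fun z => inner ℝ (G z) (G' z) + g z * g' z) μ := by
  refine Integrable.add ?_ (hg.integrable_mul hg')
  refine (hG.norm.integrable_mul hG'.norm).mono' (hG.1.inner hG'.1) ?_
  exact Eventually.of_forall fun z => norm_inner_le_norm _ _

theorem extConst_pos (hs0 : 0 < s) (hs1 : s < 1) : 0 < extConst s :=
  div_pos (Real.Gamma_pos_of_pos (by linarith))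
    (mul_pos (Real.rpow_pos_of_pos (by norm_num) _) (Real.Gamma_pos_of_pos hs0))

theorem posInd_smul_self {F : Type*} [AddCommGroup F] [Module ℝ F] {t : ℝ} {a : F}
    (h : t ≤ 0 → a = 0) : posInd t • a = a := by
  by_cases ht : 0 < t
  · simp [posInd, ht]
  · simp [h (not_lt.1 ht)]

/-- The quadratic form `(|G|² + g²)` restricted to a set of points controls the gradient there. -/
theorem ae_eq_zero_of_integral_nonpos {μ : Measure ((E n) × ℝ)} {a : (E n) × ℝ → ℝ}
    (hG : MemLp G 2 μ) (hg : MemLp g 2 μ) (ha : MemLp (fun z => a z • G z) 2 μ)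
    (ha' : MemLp (fun z => a z • g z) 2 μ) (ha0 : ∀ z, 0 ≤ a z)
    (hle : ∫ z, (inner ℝ (G z) (a z • G z) + g z * (a z • g z)) ∂μ ≤ 0) :
    ∀ᵐ z ∂μ, a z • G z = 0 ∧ a z • g z = 0 := by
  have heq (z : (E n) × ℝ) : inner ℝ (G z) (a z • G z) + g z * (a z • g z)
      = a z * (‖G z‖ ^ 2 + g z ^ 2) := by
    rw [real_inner_smul_right, real_inner_self_eq_norm_sq, smul_eq_mul]; ring
  have hnn (z : (E n) × ℝ) : 0 ≤ inner ℝ (G z) (a z • G z) + g z * (a z • g z) := by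
    rw [heq]; exact mul_nonneg (ha0 z) (by positivity)
  have h0 := (integral_eq_zero_iff_of_nonneg hnn (integrable_energy hG hg ha ha')).1
    (le_antisymm hle (integral_nonneg hnn))
  filter_upwards [h0] with z hz
  rw [Pi.zero_apply, heq, mul_eq_zero] at hz
  rcases hz with hz | hz
  · simp [hz]
  · have h1 : ‖G z‖ ^ 2 = 0 := by nlinarith [sq_nonneg ‖G z‖, sq_nonneg (g z)]
    have h2 : g z ^ 2 = 0 := by nlinarith [sq_nonneg ‖G z‖, sq_nonneg (g z)]
    simp [norm_eq_zero.1 (pow_eq_zero_iff two_ne_zero |>.1 h1),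
      pow_eq_zero_iff two_ne_zero |>.1 h2]

/-- Solutions with nonnegative datum have vanishing gradient where they are nonpositive. -/
theorem ae_gradient_eq_zero_of_nonpos (hs0 : 0 < s) (hs1 : s < 1) {f : (E n) → ℝ}
    (hf : ∀ᵐ x ∂((gaussian n).restrict Ω), 0 ≤ f x) (h : MemEnergy s Ω w G g u)
    (hsol : ∀ v V v' τ, MemEnergy s Ω v V v' τ →
      Integrable (fun x => f x * τ x) ((gaussian n).restrict Ω) ∧
        ∫ z, (inner ℝ (G z) (V z) + g z * v' z) ∂(cylMeasure s Ω)
          = extConst s * ∫ x in Ω, f x * τ x ∂(gaussian n)) :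
    ∀ᵐ z ∂(cylMeasure s Ω), w z ≤ 0 → G z = 0 ∧ g z = 0 := by
  obtain ⟨φ, hφ, -, hpos⟩ := h.exists_pos
  -- The test function is `w - w⁺ = min(w, 0)`, with gradient `(1 - posInd w)(G, g)`; its trace is
  -- nonpositive, so the right-hand side is too.
  have hneg := h.sub (hpos.memEnergy hφ)
  obtain ⟨-, h1⟩ := hsol _ _ _ _ hneg
  have hle : ∫ x in Ω, f x * (u x - max (u x) 0) ∂(gaussian n) ≤ 0 := by
    refine integral_nonpos_of_ae ?_
    filter_upwards [hf] with x hx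
    exact mul_nonpos_of_nonneg_of_nonpos hx (by simp)
  have hG (z) : G z - posInd (w z) • G z = (1 - posInd (w z)) • G z := by rw [sub_smul, one_smul]
  have hg (z) : g z - posInd (w z) • g z = (1 - posInd (w z)) • g z := by rw [sub_smul, one_smul]
  have h2 := hneg.memLp_gradX
  have h3 := hneg.memLp_derivY
  simp only [hG, hg] at h1 h2 h3
  have h4 := ae_eq_zero_of_integral_nonpos h.memLp_gradX h.memLp_derivY h2 h3
    (fun z => by linarith [le_abs_self (posInd (w z)), abs_posInd_le (w z)])
    (h1.trans_le (mul_nonpos_of_nonneg_of_nonpos (extConst_pos hs0 hs1).le hle))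
  filter_upwards [h4] with z hz hwz
  simpa [posInd, not_lt.2 hwz] using hz

/-- The test function uses `w₂⁺` instead of `w₂` because `w₂⁺` has nonnegative approximants, as
`IsTest.trunc_sub` requires. -/
theorem IsWeakSolution.comparison {Ω' : Set (E n)} (hs0 : 0 < s) (hs1 : s < 1) (hΩ : Ω ⊆ Ω')
    (hm : MeasurableSet Ω) {f ψ ζ : (E n) → ℝ}
    (hf : ∀ᵐ x ∂((gaussian n).restrict Ω), 0 ≤ f x) (hψ : IsWeakSolution s Ω f ψ)
    (hζ : IsWeakSolution s Ω' (Ω.indicator f) ζ) :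
    ∀ᵐ x ∂((gaussian n).restrict Ω), ψ x ≤ ζ x := by
  obtain ⟨w₁, G₁, g₁, hE₁, hsol₁⟩ := hψ
  obtain ⟨w₂, G₂, g₂, hE₂, hsol₂⟩ := hζ
  have hS : MeasurableSet (Ω ×ˢ (univ : Set ℝ)) := hm.prod MeasurableSet.univ
  have hrest : (gaussian n).restrict Ω = ((gaussian n).restrict Ω').restrict Ω := by
    rw [Measure.restrict_restrict hm, inter_eq_left.2 hΩ]
  have hf' : ∀ᵐ x ∂((gaussian n).restrict Ω'), 0 ≤ Ω.indicator f x := by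
    rw [hrest, ae_restrict_iff' hm] at hf
    filter_upwards [hf] with x hx using indicator_apply_nonneg hx
  have hzero := ae_gradient_eq_zero_of_nonpos hs0 hs1 hf' hE₂ hsol₂
  obtain ⟨η, hη, hη0, hpos⟩ := hE₂.exists_pos
  -- The function `w₂ - w₂⁺` has zero `y`-derivative, hence zero trace, which means `ζ = ζ⁺`.
  have hζ0 : ∀ᵐ x ∂((gaussian n).restrict Ω'), 0 ≤ ζ x := by
    obtain ⟨η', -, hl⟩ := (hE₂.sub (hpos.memEnergy hη)).exists_energyLim
    filter_upwards [hl.trace_ae_eq_zero hs0 hs1 (by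
      filter_upwards [hzero] with z hz
      rw [posInd_smul_self fun h => (hz h).2]; simp)] with x hx
    have : ζ x = max (ζ x) 0 := by simpa [sub_eq_zero] using hx
    rw [this]; exact le_max_right _ _
  obtain ⟨φ, hφ, hl₁⟩ := hE₁.exists_energyLim
  obtain ⟨k, hk⟩ := (hl₁.sub (hpos.restrict hΩ hm)).exists_pos
  have hv := hk.memEnergy fun N => (hφ (k N)).trunc_sub (hη (k N)).1 (hη0 (k N)) N
  have hcyl := cylMeasure_eq_restrict (s := s) hΩ hm
  have hzero' : ∀ᵐ z ∂(cylMeasure s Ω), w₂ z ≤ 0 → G₂ z = 0 ∧ g₂ z = 0 := by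
    rw [hcyl]; exact ae_restrict_of_ae hzero
  obtain ⟨-, e₁⟩ := hsol₁ _ _ _ _ hv
  obtain ⟨-, e₂⟩ := hsol₂ _ _ _ _ (hv.extend hΩ hm)
  set V := fun z => posInd (w₁ z - max (w₂ z) 0) • (G₁ z - posInd (w₂ z) • G₂ z) with hV
  set v' := fun z => posInd (w₁ z - max (w₂ z) 0) • (g₁ z - posInd (w₂ z) • g₂ z) with hv'
  -- Extended by zero, the test function sees only `Ω`, where the two data coincide, so both
  -- equations have the same right-hand side.
  have e₃ : ∫ z, (inner ℝ (G₂ z) (V z) + g₂ z * v' z) ∂(cylMeasure s Ω)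
      = ∫ z, (inner ℝ (G₁ z) (V z) + g₁ z * v' z) ∂(cylMeasure s Ω) := by
    rw [e₁]
    have i₁ : ∫ z, (inner ℝ (G₂ z) ((Ω ×ˢ univ).indicator V z)
        + g₂ z * (Ω ×ˢ univ).indicator v' z) ∂(cylMeasure s Ω')
        = ∫ z, (inner ℝ (G₂ z) (V z) + g₂ z * v' z) ∂(cylMeasure s Ω) := by
      rw [hcyl, ← integral_indicator hS]
      congr 1; ext z
      by_cases hz : z ∈ Ω ×ˢ (univ : Set ℝ) <;> simp only [indicator, hz] <;> simp
    rw [← i₁, e₂]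
    congr 1
    rw [hrest, ← integral_indicator hm]
    congr 1; ext x
    by_cases hx : x ∈ Ω <;> simp [hx]
  have hG₂ := (hE₂.memLp_gradX).mono_measure (hcyl.trans_le Measure.restrict_le_self)
  have hg₂ := (hE₂.memLp_derivY).mono_measure (hcyl.trans_le Measure.restrict_le_self)
  have hV2 := hv.memLp_gradX
  have hv2 := hv.memLp_derivY
  -- Since `(G₂, g₂)` vanishes a.e. where `w₂ ≤ 0`, the factor `posInd (w₂ z)` can be dropped,
  -- leaving a multiple of the difference of the two gradients.
  have hVae : ∀ᵐ z ∂(cylMeasure s Ω), V z = posInd (w₁ z - max (w₂ z) 0) • (G₁ z - G₂ z) ∧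
      v' z = posInd (w₁ z - max (w₂ z) 0) • (g₁ z - g₂ z) := by
    filter_upwards [hzero'] with z hz
    simp only [hV, hv', posInd_smul_self fun h => (hz h).1, posInd_smul_self fun h => (hz h).2,
      and_self]
  have hVae₁ := hVae.mono fun _ h => h.1
  have hVae₂ := hVae.mono fun _ h => h.2
  have hint : ∫ z, (inner ℝ (G₁ z - G₂ z) (posInd (w₁ z - max (w₂ z) 0) • (G₁ z - G₂ z))
      + (g₁ z - g₂ z) * (posInd (w₁ z - max (w₂ z) 0) • (g₁ z - g₂ z))) ∂(cylMeasure s Ω)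
      = 0 := by
    refine Eq.trans ?_ (sub_eq_zero.2 e₃.symm)
    rw [← integral_sub
      (integrable_energy hE₁.memLp_gradX hE₁.memLp_derivY hV2 hv2)
      (integrable_energy hG₂ hg₂ hV2 hv2)]
    refine integral_congr_ae ?_
    filter_upwards [hVae] with z hz
    rw [← hz.1, ← hz.2, inner_sub_left]
    ring
  have hgrad := ae_eq_zero_of_integral_nonpos (hE₁.memLp_gradX.sub hG₂)
    (hE₁.memLp_derivY.sub hg₂) (hV2.ae_eq hVae₁) (hv2.ae_eq hVae₂)
    (fun z => by unfold posInd; split_ifs <;> norm_num) hint.le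
  have htrace := hk.trace_ae_eq_zero hs0 hs1 (by
    filter_upwards [hgrad, hVae₂] with z hz hz'
    exact hz'.trans hz.2)
  have hζ0' : ∀ᵐ x ∂((gaussian n).restrict Ω), 0 ≤ ζ x := by
    rw [hrest]; exact ae_restrict_of_ae hζ0
  filter_upwards [htrace, hζ0'] with x hx hx0
  have h1 : ψ x - max (ζ x) 0 ≤ 0 := max_eq_right_iff.1 hx
  rw [max_eq_left hx0] at h1
  linarith

/-! ### The Gaussian measure and half-spaces -/

theorem gaussian_absolutelyContinuous : gaussian n ≪ volume :=
  withDensity_absolutelyContinuous _ _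

theorem absolutelyContinuous_gaussian : (volume : Measure (E n)) ≪ gaussian n := by
  refine withDensity_absolutelyContinuous' ?_ ?_
  · have : Measurable fun x : E n =>
        ENNReal.ofReal ((2 * Real.pi) ^ (-(n : ℝ) / 2) * Real.exp (-‖x‖ ^ 2 / 2)) := by fun_prop
    exact this.aemeasurable
  · refine Eventually.of_forall fun x => ?_
    have : 0 < (2 * Real.pi) ^ (-(n : ℝ) / 2) * Real.exp (-‖x‖ ^ 2 / 2) := by positivity
    simpa using this

theorem measurableSet_halfSpace [NeZero n] (ω : ℝ) : MeasurableSet (halfSpace n ω) :=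
  measurableSet_lt measurable_const (by fun_prop)

theorem halfSpace_subset [NeZero n] {ω ω' : ℝ} (h : ω' ≤ ω) : halfSpace n ω ⊆ halfSpace n ω' :=
  fun _ hx => lt_of_le_of_lt h hx

end GaussOU

theorem mainTheorem10 (n : ℕ) [NeZero n] (s : ℝ) (hs0 : 0 < s) (hs1 : s < 1)
    (ω : ℝ) (hω : 0 < ω) (p α : ℝ) (hp : 1 ≤ p)
    (h ψ ζ : EuclideanSpace ℝ (Fin n) → ℝ)
    (hmem : GaussOU.MemZygmund p α (GaussOU.halfSpace n ω) h)
    (hnonneg : ∀ᵐ x ∂(volume.restrict (GaussOU.halfSpace n ω)), 0 ≤ h x)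
    (hrearr : ∀ᵐ x ∂(volume.restrict (GaussOU.halfSpace n ω)),
      h x = GaussOU.rearr (GaussOU.halfSpace n ω) h x)
    (hψ : GaussOU.IsWeakSolution s (GaussOU.halfSpace n ω) h ψ)
    (hζ : GaussOU.IsWeakSolution s (GaussOU.halfSpace n 0)
      ((GaussOU.halfSpace n ω).indicator h) ζ) :
    ∀ᵐ x ∂(volume.restrict (GaussOU.halfSpace n ω)), ψ x ≤ ζ x :=
  -- The Gaussian density is positive, so Lebesgue and Gaussian null sets agree, and a.e. statements
  -- pass both ways.
  (GaussOU.absolutelyContinuous_gaussian.restrict _).ae_le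
    (hψ.comparison hs0 hs1 (GaussOU.halfSpace_subset hω.le) (GaussOU.measurableSet_halfSpace ω)
      ((GaussOU.gaussian_absolutelyContinuous.restrict _).ae_le hnonneg) hζ)
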